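/- Write $[n]=\{1,\dots,n\}$. A decorated permutation $w$ on $[n]$ is a permutation $w\in S_n$ together with an orientation, clockwise or counterclockwise, of each of its fixed points. For $r\in[n]$ let $<_r$ be the linear order $r<_r r+1<_r\cdots<_r n<_r 1<_r\cdots<_r r-1$, and let $$I_r(w)=\{i\in[n] : i<_r w^{-1}(i),\ \text{or } i \text{ is a clockwise fixed point of } w\}.$$ The elements of $I_1(w)$ are the anti-exceedances of $w$ (for $n=0$, $I_1(w)=\emptyset$). For $k$-subsets $I=\{i_1<_r\cdots<_r i_k\}$ and $J=\{j_1<_r\cdots<_r j_k\}$ of $[n]$ write $I\preceq_r J$ if $i_h\le_r j_h$ for all $h\in[k]$, and write $\preceq$ for this relation with respect to the usual order on $[n]$. For $y\in S_n$ and $0\le m\le n$ let $y[m]=\{y(1),\dots,y(m)\}$ be the initial set of $y$ of size $m$. Bruhat order on $S_n$ is given by $u\le v$ if and only if $u[m]\preceq v[m]$ for all $m\in[n]$, and $[u,v]=\{y\in S_n: u\le y\le v\}$. **Theorem.** Let $w$ be a decorated permutation on $[n]$ with exactly $k$ anti-exceedances. Let $$\mathcal M(w)=\Big\{I\in\tbinom{[n]}{k}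 : I_r(w)\preceq_r I\ \text{ for all } r\in[n]\Big\}$$ be its positroid, and let $[u,v]$ be its Grassmann interval: $v\in S_n$ is the permutation with $v(1)<\cdots<v(k)$, $v(k+1)<\cdots<v(n)$ and $v[k]=w^{-1}(I_1(w))$, and $u=wv$ (that is, $u(i)=w(v(i))$ for all $i$). Then $$\mathcal M(w)=\{\,y[k] : y\in[u,v]\,\}.$$ -/

import Mathlib

/-! The set `[n] = {1, …, n}` is modelled by `Fin n = {0, …, n-1}`, and `S_n` by
`Equiv.Perm (Fin n)`, whose product is composition of functions. -/

/-- For a strict linear order `lt`, the Gale order on finite sets of the same size: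
`I = {i_1 < ⋯ < i_k}` is below `J = {j_1 < ⋯ < j_k}` when `i_h ≤ j_h` for all `h`. -/
def GaleLE {α : Type*} [DecidableEq α] (lt : α → α → Prop) (I J : Finset α) : Prop :=
  ∃ (k : ℕ) (i j : Fin k → α),
    (∀ a b, a < b → lt (i a) (i b)) ∧ Finset.univ.image i = I ∧
    (∀ a b, a < b → lt (j a) (j b)) ∧ Finset.univ.image j = J ∧
    ∀ h, i h = j h ∨ lt (i h) (j h)

/-- The shifted linear order `r <_r r+1 <_r ⋯ <_r n <_r 1 <_r ⋯ <_r r-1`. -/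
def ShiftedLT {n : ℕ} (r i j : Fin n) : Prop :=
  (r ≤ i ∧ i < j) ∨ (i < j ∧ j < r) ∨ (j < r ∧ r ≤ i)

/-- The initial set `y[m] = {y_1, …, y_m}` of a permutation. -/
def initialSet {n : ℕ} (y : Equiv.Perm (Fin n)) (m : ℕ) : Finset (Fin n) :=
  (Finset.univ.filter fun i : Fin n => i.val < m).image y

/-- Bruhat order on `S_n`: `u[m] ⪯ v[m]` in Gale order for all `m ∈ [n]`. -/
def BruhatLE {n : ℕ} (u v : Equiv.Perm (Fin n)) : Prop :=
  ∀ m : ℕ, 1 ≤ m → m ≤ n → GaleLE (· < ·) (initialSet u m) (initialSet v m)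

/-- The Bruhat interval `[u, v]`. -/
def bruhatInterval {n : ℕ} (u v : Equiv.Perm (Fin n)) : Set (Equiv.Perm (Fin n)) :=
  {y | BruhatLE u y ∧ BruhatLE y v}

/-- `v_1 < ⋯ < v_k` and `v_{k+1} < ⋯ < v_n`. -/
def IsGrassmannian {n : ℕ} (k : ℕ) (v : Equiv.Perm (Fin n)) : Prop :=
  StrictMonoOn v {i | i.val < k} ∧ StrictMonoOn v {i | k ≤ i.val}

/-- The permutation whose one-line notation lists the elements of `P` in increasing order,
followed by the elements of the complement of `P` in increasing order. -/
def grassmannianPerm {n : ℕ} (P : Finset (Fin n)) : Equiv.Perm (Fin n) :=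
  (finCongr (by rw [Finset.card_add_card_compl, Fintype.card_fin] :
      n = P.card + Pᶜ.card)).trans
    (finSumFinEquiv.symm.trans (finSumEquivOfFinset rfl rfl))

theorem grassmannianPerm_of_lt {n : ℕ} (P : Finset (Fin n)) (i : Fin n) (h : i.val < P.card) :
    grassmannianPerm P i = P.orderEmbOfFin rfl ⟨i.val, h⟩ := by
  have : finCongr (by rw [Finset.card_add_card_compl, Fintype.card_fin] :
      n = P.card + Pᶜ.card) i = Fin.castAdd Pᶜ.card ⟨i.val, h⟩ := rfl
  simp only [grassmannianPerm, Equiv.trans_apply, this, finSumFinEquiv_symm_apply_castAdd,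
    finSumEquivOfFinset_inl]

theorem grassmannianPerm_of_ge {n : ℕ} (P : Finset (Fin n)) (i : Fin n) (h : P.card ≤ i.val) :
    grassmannianPerm P i = Pᶜ.orderEmbOfFin rfl ⟨i.val - P.card, by
      have := P.card_add_card_compl
      rw [Fintype.card_fin] at this
      omega⟩ := by
  have h2 : i.val - P.card < Pᶜ.card := by
    have := P.card_add_card_compl
    rw [Fintype.card_fin] at this
    omega
  have : finCongr (by rw [Finset.card_add_card_compl, Fintype.card_fin] :
      n = P.card + Pᶜ.card) i = Fin.natAdd P.card ⟨i.val - P.card, h2⟩ := by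
    ext
    simp only [finCongr_apply, Fin.val_cast, Fin.natAdd_mk]
    omega
  simp only [grassmannianPerm, Equiv.trans_apply, this, finSumFinEquiv_symm_apply_natAdd,
    finSumEquivOfFinset_inr]

/-- `grassmannianPerm P` is `|P|`-Grassmannian. -/
theorem isGrassmannian_grassmannianPerm {n : ℕ} (P : Finset (Fin n)) :
    IsGrassmannian P.card (grassmannianPerm P) := by
  refine ⟨fun i hi j hj hij => ?_, fun i hi j hj hij => ?_⟩
  · rw [grassmannianPerm_of_lt P i hi, grassmannianPerm_of_lt P j hj]
    exact (P.orderEmbOfFin rfl).strictMono hij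
  · rw [grassmannianPerm_of_ge P i hi, grassmannianPerm_of_ge P j hj]
    refine (Pᶜ.orderEmbOfFin rfl).strictMono ?_
    change P.card ≤ i.val at hi
    change P.card ≤ j.val at hj
    rw [Fin.lt_def] at hij ⊢
    simp only
    omega

/-- The initial set of length `|P|` of `grassmannianPerm P` is `P`. -/
theorem initialSet_grassmannianPerm {n : ℕ} (P : Finset (Fin n)) :
    initialSet (grassmannianPerm P) P.card = P := by
  have hle : P.card ≤ n := by simpa using P.card_le_univ
  refine Finset.eq_of_subset_of_card_le (fun x hx => ?_) ?_
  · simp only [initialSet, Finset.mem_image, Finset.mem_filter, Finset.mem_univ,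
      true_and] at hx
    obtain ⟨i, hi, rfl⟩ := hx
    rw [grassmannianPerm_of_lt P i hi]
    exact P.orderEmbOfFin_mem rfl _
  · rw [initialSet, Finset.card_image_of_injective _ (Equiv.injective _)]
    rw [Fin.card_filter_val_lt, min_eq_right hle]

/-- Orientations of a fixed point: clockwise or counterclockwise. -/
inductive CircularOrientation
  | cw
  | ccw

/-- A decorated permutation on `n` elements: a permutation with an orientation of each of its
fixed points. -/
structure DecoratedPerm (n : ℕ) where
  perm : Equiv.Perm (Fin n)
  co : {i : Fin n // perm i = i} → CircularOrientation

namespace DecoratedPerm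

open Classical in
/-- The anti-exceedances with respect to a linear order `lt`: the `i` with `i < w⁻¹(i)`, and the
clockwise fixed points. -/
noncomputable def antiExceedanceSet {n : ℕ} (w : DecoratedPerm n) (lt : Fin n → Fin n → Prop) :
    Finset (Fin n) :=
  Finset.univ.filter fun i =>
    lt i (w.perm⁻¹ i) ∨ ∃ h : w.perm i = i, w.co ⟨i, h⟩ = CircularOrientation.cw

/-- The set `I_1(w)` of anti-exceedances of `w`. -/
noncomputable def antiExceedances {n : ℕ} (w : DecoratedPerm n) : Finset (Fin n) :=
  w.antiExceedanceSet (· < ·)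

/-- The Grassmann necklace `(I_1(w), …, I_n(w))` of shifted anti-exceedance sets. -/
noncomputable def necklace {n : ℕ} (w : DecoratedPerm n) (r : Fin n) : Finset (Fin n) :=
  w.antiExceedanceSet (ShiftedLT r)

/-- The set of decorated permutations on `n` elements with `k` anti-exceedances. -/
def withAntiExceedances (n k : ℕ) : Set (DecoratedPerm n) :=
  {w | w.antiExceedances.card = k}

/-- The upper end `v` of the Grassmann interval of `w`: the `k`-Grassmannian permutation with
`v[k] = w⁻¹(I_1(w))`, where `k = |I_1(w)|`. -/
noncomputable def upper {n : ℕ} (w : DecoratedPerm n) : Equiv.Perm (Fin n) :=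
  grassmannianPerm (w.antiExceedances.image w.perm.symm)

/-- The lower end `u = w v` of the Grassmann interval of `w`. -/
noncomputable def lower {n : ℕ} (w : DecoratedPerm n) : Equiv.Perm (Fin n) :=
  w.perm * w.upper

/-- The Grassmann interval `[u, v]` associated to `w`. -/
noncomputable def grassmannInterval {n : ℕ} (w : DecoratedPerm n) : Set (Equiv.Perm (Fin n)) :=
  bruhatInterval w.lower w.upper

/-- The positroid `M(w)`, as its set of bases: the sets `I` of size `|I_1(w)|` with
`I_r(w) ⪯_r I` in the shifted Gale order, for all `r`. -/
def positroid {n : ℕ} (w : DecoratedPerm n) : Set (Finset (Fin n)) :=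
  {I | I.card = w.antiExceedances.card ∧ ∀ r : Fin n, GaleLE (ShiftedLT r) (w.necklace r) I}

end DecoratedPerm

/-!
Write `k = |I_1(w)|`, `v = w.upper` and `u = w.lower`. Since `w⁻¹ (u a) = v a`, the decorated
permutation is encoded by the pairs `(u a, v a)`, where `u a ≤ v a` for the places `a < k` and
`v a ≤ u a` for the places `a ≥ k`. Both sides of the claimed equality are compared with the
*interval conditions* on a `k`-subset `I`: an interval `[r, x)` contains at least as many elements
of `I` as it contains intervals `[u a, v a]` with `a < k`, and at least as many elements of the
complement of `I` as it contains intervals `[v a, u a]` with `a ≥ k`.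

* `DecoratedPerm.mem_positroid_iff`: these conditions describe the positroid. The condition
  `I_r(w) ⪯_r I` compares the number of elements of `I_r(w)` and of `I` in each cyclic interval that
  starts at `r`, and `card_necklace_interval` and `card_necklace_cyclic` count the former. Cyclic
  intervals that do not wrap around give the condition on the complement of `I`, those that do
  give the condition on `I` (for an interval that reaches `n`, it follows from the condition on
  the complement).
* `IntervalConditions.exists_perm`: for intervals, Hall's condition need only be tested on
  intervals (`exists_injective_mem_Icc`), so the interval conditions yield a permutation `y` with
  `y[k] = I` and with `y a` between `u a` and `v a` at every place `a`. Every such `y` lies in the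
  Bruhat interval `[u, v]` (`bruhatLE_of_pointwise`).
* `intervalConditions_of_mem_bruhatInterval`: conversely `y[k]` satisfies the interval conditions
  for all `y ∈ [u, v]`, by the description of Bruhat order through counts
  `#{a < m : y a < x}` and because `v` is Grassmannian.
-/

section

open Finset

/-! ### The Gale order and Bruhat order by counting -/

theorem exists_strictMono_enumeration {α : Type*} [DecidableEq α] (f : α → ℕ)
    (hf : Function.Injective f) {k : ℕ} (I : Finset α) (hI : #I = k) :
    ∃ i : Fin k → α, StrictMono (f ∘ i) ∧ univ.image i = I := by
  have hc : #(I.image f) = k := by rw [card_image_of_injective _ hf, hI]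
  have h : ∀ h : Fin k, ∃ a ∈ I, f a = (I.image f).orderEmbOfFin hc h := fun h =>
    mem_image.1 ((I.image f).orderEmbOfFin_mem hc h)
  choose i hi hfi using h
  have hmono : StrictMono (f ∘ i) := fun a b hab => by
    simp only [Function.comp_apply, hfi]
    exact ((I.image f).orderEmbOfFin hc).strictMono hab
  refine ⟨i, hmono, eq_of_subset_of_card_le ?_ ?_⟩
  · intro a ha
    obtain ⟨b, -, rfl⟩ := mem_image.1 ha
    exact hi b
  · rw [card_image_of_injective _ hmono.injective.of_comp, hI, card_univ, Fintype.card_fin]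

theorem card_filter_image_univ {α ι : Type*} [Fintype ι] [DecidableEq α] {i : ι → α}
    (hi : Function.Injective i) (p : α → Prop) [DecidablePred p] :
    #{a ∈ univ.image i | p a} = #{h | p (i h)} := by
  rw [filter_image, card_image_of_injective _ hi]

/-- For the order pulled back from `ℕ` along an injection, the Gale order says that every initial
segment contains at least as many elements of `I` as of `J`. -/
theorem galeLE_iff_card {α : Type*} [DecidableEq α] (f : α → ℕ) (hf : Function.Injective f)
    (I J : Finset α) :
    GaleLE (fun a b => f a < f b) I J ↔
      #I = #J ∧ ∀ x, #{j ∈ J | f j < x} ≤ #{i ∈ I | f i < x} := by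
  constructor
  · rintro ⟨k, i, j, hi, rfl, hj, rfl, hij⟩
    have hi' : Function.Injective i := (show StrictMono (f ∘ i) from hi).injective.of_comp
    have hj' : Function.Injective j := (show StrictMono (f ∘ j) from hj).injective.of_comp
    refine ⟨by rw [card_image_of_injective _ hi', card_image_of_injective _ hj'], fun x => ?_⟩
    rw [card_filter_image_univ hi', card_filter_image_univ hj']
    refine card_le_card fun h => ?_
    simp only [mem_filter, mem_univ, true_and]
    intro hx
    rcases hij h with e | e
    · rwa [e]
    · exact e.trans hx
  · rintro ⟨hc, h⟩
    obtain ⟨i, hi, rfl⟩ := exists_strictMono_enumeration f hf I hc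
    obtain ⟨j, hj, hJ⟩ := exists_strictMono_enumeration f hf J rfl
    refine ⟨_, i, j, hi, rfl, hj, hJ, fun c => ?_⟩
    by_contra! hlt
    have hlt' : f (j c) < f (i c) := lt_of_le_of_ne hlt.2 fun e => hlt.1 (hf e).symm
    have hx := h (f (j c) + 1)
    have h1 : #{b ∈ J | f b < f (j c) + 1} = #{b | f (j b) < f (j c) + 1} := by
      conv_lhs => rw [← hJ]
      exact card_filter_image_univ hj.injective.of_comp _
    rw [card_filter_image_univ hi.injective.of_comp, h1] at hx
    have h2 : #(Iic c) ≤ #{b | f (j b) < f (j c) + 1} := card_le_card fun b hb => by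
      simpa [Nat.lt_succ_iff] using hj.monotone (mem_Iic.1 hb)
    have h3 : #{b | f (i b) < f (j c) + 1} ≤ #(Iio c) := card_le_card fun b hb => by
      rw [mem_filter] at hb
      rw [mem_Iio]
      by_contra! hcb
      have : f (i c) ≤ f (i b) := hi.monotone hcb
      omega
    rw [Fin.card_Iic] at h2
    rw [Fin.card_Iio] at h3
    omega

theorem card_filter_comp_perm {n : ℕ} (y : Equiv.Perm (Fin n)) (p : Fin n → Prop)
    [DecidablePred p] : #{a | p (y a)} = #{i | p i} := by
  rw [← card_filter_image_univ y.injective, image_univ_equiv]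

theorem card_filter_add_card_filter_compl {n : ℕ} (I : Finset (Fin n))
    (p : Fin n → Prop) [DecidablePred p] : #{i ∈ I | p i} + #{i ∈ Iᶜ | p i} = #{i | p i} := by
  rw [← card_union_of_disjoint (disjoint_filter_filter disjoint_compl_right), ← filter_union,
    union_compl]

theorem mem_initialSet {n : ℕ} (y : Equiv.Perm (Fin n)) (m : ℕ) (a : Fin n) :
    y a ∈ initialSet y m ↔ a.val < m := by
  simp [initialSet]

theorem card_filter_initialSet {n : ℕ} (y : Equiv.Perm (Fin n)) (m : ℕ) (p : Fin n → Prop)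
    [DecidablePred p] : #{i ∈ initialSet y m | p i} = #{a | a.val < m ∧ p (y a)} := by
  rw [initialSet, filter_image, card_image_of_injective _ y.injective, filter_filter]

theorem card_initialSet {n : ℕ} (y : Equiv.Perm (Fin n)) (m : ℕ) :
    #(initialSet y m) = #{a : Fin n | a.val < m} :=
  card_image_of_injective _ y.injective

theorem bruhatLE_iff_card {n : ℕ} (u v : Equiv.Perm (Fin n)) :
    BruhatLE u v ↔ ∀ m x : ℕ,
      #{a | a.val < m ∧ (v a).val < x} ≤ #{a | a.val < m ∧ (u a).val < x} := by
  have key : ∀ m, GaleLE (· < ·) (initialSet u m) (initialSet v m) ↔ ∀ x : ℕ,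
      #{a | a.val < m ∧ (v a).val < x} ≤ #{a | a.val < m ∧ (u a).val < x} := fun m => by
    refine (galeLE_iff_card (Fin.val : Fin n → ℕ) Fin.val_injective _ _).trans ?_
    simp [card_filter_initialSet, card_initialSet]
  refine ⟨fun h m x => ?_, fun h m _ _ => (key m).2 (h m)⟩
  rcases Nat.eq_zero_or_pos m with rfl | hm
  · simp
  rcases le_or_gt m n with hmn | hmn
  · exact (key m).1 (h m hm hmn) x
  rcases Nat.eq_zero_or_pos n with rfl | hn
  · simp
  -- for `m > n` the initial sets are everything, as for `m = n`
  have h1 := (key n).1 (h n hn le_rfl) x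
  have h2 : ∀ a : Fin n, a.val < m := fun a => a.isLt.trans hmn
  simpa [h2] using h1

/-- Pointwise comparison, reversed after the first `k` places, implies Bruhat comparison: initial
sets of size at most `k` compare entry by entry, and larger ones through their complements. -/
theorem bruhatLE_of_pointwise {n k : ℕ} {u v : Equiv.Perm (Fin n)}
    (hlow : ∀ a : Fin n, a.val < k → u a ≤ v a) (hhigh : ∀ a : Fin n, k ≤ a.val → v a ≤ u a) :
    BruhatLE u v := by
  rw [bruhatLE_iff_card]
  intro m x
  rcases le_total m k with hm | hm
  · refine card_le_card fun a => ?_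
    simp only [mem_filter, mem_univ, true_and]
    rintro ⟨h1, h2⟩
    exact ⟨h1, lt_of_le_of_lt (hlow a (by omega)) h2⟩
  · -- both permutations take the same number of values below `x`, so that the count over the
    -- places from `m` on may be compared instead
    have h0 : #{a | (v a).val < x} = #{a | (u a).val < x} :=
      (card_filter_comp_perm v (·.val < x)).trans (card_filter_comp_perm u (·.val < x)).symm
    have h1 : ∀ y : Equiv.Perm (Fin n), #{a | (y a).val < x} =
        #{a | a.val < m ∧ (y a).val < x} + #{a | m ≤ a.val ∧ (y a).val < x} := fun y => by
      simp only [card_filter, ← sum_add_distrib]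
      refine sum_congr rfl fun a _ => ?_
      split_ifs <;> omega
    have h2 : #{a | m ≤ a.val ∧ (u a).val < x} ≤ #{a | m ≤ a.val ∧ (v a).val < x} := by
      refine card_le_card fun a => ?_
      simp only [mem_filter, mem_univ, true_and]
      rintro ⟨h1, h2⟩
      exact ⟨h1, lt_of_le_of_lt (hhigh a (by omega)) h2⟩
    have := h1 u
    have := h1 v
    omega

/-! ### Systems of distinct representatives for intervals -/

/-- For a family of nonempty intervals, a count over integer intervals bounds the count over
arbitrary finite sets of integers, by splitting off the first run of consecutive elements. -/
theorem card_filter_Icc_subset_le {ι : Type*} [Fintype ι] (p q : ι → ℕ) (hpq : ∀ a, p a ≤ q a)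
    (J : Finset ℕ) (h : ∀ x y, #{a | x ≤ p a ∧ q a < y} ≤ #{j ∈ J | x ≤ j ∧ j < y})
    (U : Finset ℕ) : #{a | Icc (p a) (q a) ⊆ U} ≤ #(J ∩ U) := by
  induction U using Finset.strongInduction with
  | H U ih =>
  rcases U.eq_empty_or_nonempty with rfl | hU
  · simp [subset_empty, Icc_eq_empty_iff, hpq]
  set x := U.min' hU
  have hx : x ∈ U := U.min'_mem hU
  have hmin : ∀ z ∈ U, x ≤ z := fun z hz => U.min'_le z hz
  have hex : ∃ y, x ≤ y ∧ y ∉ U := by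
    refine ⟨U.max' hU + 1, ?_, fun hy => ?_⟩
    · have := U.min'_le_max' hU
      omega
    · have := U.le_max' _ hy
      omega
  obtain ⟨y, ⟨hxy, hyU⟩, hy⟩ : ∃ y, (x ≤ y ∧ y ∉ U) ∧ ∀ z, x ≤ z → z < y → z ∈ U := by
    classical
    refine ⟨Nat.find hex, Nat.find_spec hex, fun z hz hzy => ?_⟩
    by_contra hzU
    exact Nat.find_min hex hzy ⟨hz, hzU⟩
  set V := U.filter (y < ·)
  have hV : V ⊂ U := by
    refine filter_ssubset.2 ⟨x, hx, by omega⟩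
  have h1 := ih V hV
  have h2 := h x y
  have h3 : #{a | Icc (p a) (q a) ⊆ U} ≤
      #{a | x ≤ p a ∧ q a < y} + #{a | Icc (p a) (q a) ⊆ V} := by
    classical
    refine (card_le_card fun a ha => ?_).trans (card_union_le _ _)
    simp only [mem_filter, mem_univ, true_and, mem_union] at ha ⊢
    have hp := hmin _ (ha (left_mem_Icc.2 (hpq a)))
    -- the interval avoids the gap `y`
    have hgap : ¬ (p a ≤ y ∧ y ≤ q a) := fun hc => hyU (ha (mem_Icc.2 hc))
    rcases lt_or_ge (q a) y with hq | hq
    · exact Or.inl ⟨hp, hq⟩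
    · refine Or.inr fun z hz => mem_filter.2 ⟨ha hz, ?_⟩
      rw [mem_Icc] at hz
      omega
  have h4 : #{j ∈ J | x ≤ j ∧ j < y} + #(J ∩ V) ≤ #(J ∩ U) := by
    rw [← card_union_of_disjoint]
    · refine card_le_card fun z hz => ?_
      simp only [mem_union, mem_filter, mem_inter, V] at hz ⊢
      rcases hz with ⟨hz, hz1, hz2⟩ | ⟨hz, hz1, -⟩
      · exact ⟨hz, hy z hz1 hz2⟩
      · exact ⟨hz, hz1⟩
    · rw [disjoint_left]
      intro z hz hz'
      simp only [mem_filter, mem_inter, V] at hz hz'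
      omega
  omega

/-- Hall's condition for a family of integer intervals need only be tested on intervals. -/
theorem exists_injective_mem_Icc {ι : Type*} [Fintype ι] (p q : ι → ℕ) (hpq : ∀ a, p a ≤ q a)
    (J : Finset ℕ) (h : ∀ x y, #{a | x ≤ p a ∧ q a < y} ≤ #{j ∈ J | x ≤ j ∧ j < y}) :
    ∃ f : ι → ℕ, Function.Injective f ∧ ∀ a, f a ∈ J ∧ p a ≤ f a ∧ f a ≤ q a := by
  classical
  obtain ⟨f, hf, hmem⟩ :=
    (all_card_le_biUnion_card_iff_exists_injective fun a => J ∩ Icc (p a) (q a)).1 fun s => by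
      rw [← inter_biUnion]
      refine le_trans (card_le_card fun a ha => ?_)
        (card_filter_Icc_subset_le p q hpq J h (s.biUnion fun a => Icc (p a) (q a)))
      simp only [mem_filter, mem_univ, true_and]
      exact subset_biUnion_of_mem (fun a => Icc (p a) (q a)) ha
  refine ⟨f, hf, fun a => ?_⟩
  simpa using hmem a

/-- The same inside `Fin n`, for the members of a family that satisfy a predicate. -/
theorem exists_injOn_mem_Icc {n : ℕ} (P : Fin n → Prop) [DecidablePred P] (p q : Fin n → Fin n)
    (hpq : ∀ a, P a → p a ≤ q a) (J : Finset (Fin n))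
    (h : ∀ x y : ℕ, #{a | P a ∧ x ≤ (p a).val ∧ (q a).val < y} ≤
      #{j ∈ J | x ≤ j.val ∧ j.val < y}) :
    ∃ f : Fin n → Fin n, Set.InjOn f {a | P a} ∧
      ∀ a, P a → f a ∈ J ∧ p a ≤ f a ∧ f a ≤ q a := by
  obtain ⟨f, hf, hmem⟩ := exists_injective_mem_Icc (ι := {a // P a}) (fun a => (p a).val)
    (fun a => (q a).val) (fun a => hpq a a.2) (J.map Fin.valEmbedding) fun x y => by
      rw [filter_map, card_map]
      refine le_trans (le_of_eq ?_) (h x y)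
      rw [← card_map (Function.Embedding.subtype P)]
      congr 1
      ext a
      simp
      tauto
  simp only [mem_map, Fin.valEmbedding_apply] at hmem
  choose g hg using fun a => (hmem a).1
  refine ⟨fun a => if ha : P a then g ⟨a, ha⟩ else a, fun a ha b hb hab => ?_, fun a ha => ?_⟩
  · rw [Set.mem_ofPred_eq] at ha hb
    simp only [ha, hb, dif_pos] at hab
    have := hf ((hg ⟨a, ha⟩).2.symm.trans ((congrArg Fin.val hab).trans (hg ⟨b, hb⟩).2))
    simpa using this
  · simp only [ha, dif_pos]
    have h1 := hmem ⟨a, ha⟩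
    rw [← (hg ⟨a, ha⟩).2] at h1
    exact ⟨(hg ⟨a, ha⟩).1, h1.2⟩

/-! ### Interval conditions and the Bruhat interval -/

/-- The interval conditions on `I`: for every interval `[r, x)`, the number of places `a < k`
with `[u a, v a]` inside it is at most the number of elements of `I` in it, and the number of
places `a ≥ k` with `[v a, u a]` inside it is at most the number of elements of `Iᶜ` in it. -/
def IntervalConditions {n : ℕ} (k : ℕ) (u v : Equiv.Perm (Fin n)) (I : Finset (Fin n)) : Prop :=
  (∀ r x : ℕ, #{a | a.val < k ∧ r ≤ (u a).val ∧ (v a).val < x} ≤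
    #{i ∈ I | r ≤ i.val ∧ i.val < x}) ∧
  ∀ r x : ℕ, #{a | k ≤ a.val ∧ r ≤ (v a).val ∧ (u a).val < x} ≤
    #{i ∈ Iᶜ | r ≤ i.val ∧ i.val < x}

/-- Hall's theorem fills the first `k` places from `I` and the others from `Iᶜ`, with entries
between those of `u` and `v`; such a permutation lies in `[u, v]`. -/
theorem IntervalConditions.exists_perm {n k : ℕ} {u v : Equiv.Perm (Fin n)} {I : Finset (Fin n)}
    (h : IntervalConditions k u v I)
    (hlow : ∀ a : Fin n, a.val < k → u a ≤ v a) (hhigh : ∀ a : Fin n, k ≤ a.val → v a ≤ u a) :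
    ∃ y ∈ bruhatInterval u v, I = initialSet y k := by
  obtain ⟨f, hf, hfm⟩ := exists_injOn_mem_Icc (fun a : Fin n => a.val < k) u v hlow I h.1
  obtain ⟨g, hg, hgm⟩ := exists_injOn_mem_Icc (fun a : Fin n => k ≤ a.val) v u hhigh Iᶜ h.2
  have hinj : Function.Injective fun a : Fin n => if a.val < k then f a else g a := by
    intro a b hab
    by_cases ha : a.val < k <;> by_cases hb : b.val < k <;>
      simp only [ha, hb, if_true, if_false] at hab
    · exact hf ha hb hab
    · exact absurd (hab ▸ (hfm a ha).1) (mem_compl.1 (hgm b (not_lt.1 hb)).1)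
    · exact absurd (hab ▸ (hfm b hb).1) (mem_compl.1 (hgm a (not_lt.1 ha)).1)
    · exact hg (not_lt.1 ha) (not_lt.1 hb) hab
  set y : Equiv.Perm (Fin n) := Equiv.ofBijective _ (Finite.injective_iff_bijective.1 hinj)
  have hy1 : ∀ a : Fin n, a.val < k → y a = f a := fun a ha => if_pos ha
  have hy2 : ∀ a : Fin n, k ≤ a.val → y a = g a := fun a ha => if_neg (not_lt.2 ha)
  refine ⟨y, ⟨bruhatLE_of_pointwise (k := k) (fun a ha => ?_) (fun a ha => ?_),
    bruhatLE_of_pointwise (k := k) (fun a ha => ?_) (fun a ha => ?_)⟩, ?_⟩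
  · exact hy1 a ha ▸ (hfm a ha).2.1
  · exact hy2 a ha ▸ (hgm a ha).2.2
  · exact hy1 a ha ▸ (hfm a ha).2.2
  · exact hy2 a ha ▸ (hgm a ha).2.1
  · ext i
    obtain ⟨a, rfl⟩ := y.surjective i
    rw [mem_initialSet]
    rcases lt_or_ge a.val k with ha | ha
    · simp [ha, hy1, (hfm a ha).1]
    · have := mem_compl.1 (hgm a ha).1
      simp [not_lt.2 ha, hy2 a ha, this]

theorem exists_threshold {n : ℕ} {v : Equiv.Perm (Fin n)} {S : Set (Fin n)}
    (hv : StrictMonoOn v S) (r : ℕ) : ∃ m : ℕ, ∀ a ∈ S, a.val < m ↔ (v a).val < r := by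
  classical
  have hex : ∃ m : ℕ, ∀ a ∈ S, m ≤ a.val → r ≤ (v a).val :=
    ⟨n, fun a _ ha => absurd a.isLt (not_lt.2 ha)⟩
  refine ⟨Nat.find hex, fun a ha => ⟨fun h => ?_, fun h => ?_⟩⟩
  · have := Nat.find_min hex h
    push Not at this
    obtain ⟨b, hb, hab, hbr⟩ := this
    exact lt_of_le_of_lt (hv.monotoneOn ha hb hab) hbr
  · by_contra! h'
    exact absurd (Nat.find_spec hex a ha h') (not_le.2 h)

/-- Members of the Bruhat interval below a Grassmannian permutation satisfy the interval
conditions: as `v` is increasing on either block of places, the condition on `v a` in each of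
them singles out an initial or a final segment of places, where Bruhat order counts. -/
theorem intervalConditions_of_mem_bruhatInterval {n k : ℕ} {u v y : Equiv.Perm (Fin n)}
    (hv : IsGrassmannian k v) (hy : y ∈ bruhatInterval u v) :
    IntervalConditions k u v (initialSet y k) := by
  obtain ⟨huy, hyv⟩ := hy
  rw [bruhatLE_iff_card] at huy hyv
  constructor
  · intro r x
    obtain ⟨m₀, hm₀⟩ := exists_threshold hv.1 x
    set m := min m₀ k
    have hm : ∀ a : Fin n, a.val < m ↔ a.val < k ∧ (v a).val < x := fun a => by
      have := hm₀ a
      simp only [Set.mem_ofPred_eq] at this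
      omega
    have h1 := huy m r
    have h2 := hyv m x
    rw [card_filter_initialSet]
    have e1 : #{a | a.val < m ∧ (v a).val < x} = #{a : Fin n | a.val < m} := by
      congr 1
      ext a
      have := hm a
      simp
      omega
    have e2 : ∀ z : Equiv.Perm (Fin n), #{a | a.val < m ∧ (z a).val < r} +
        #{a | a.val < m ∧ r ≤ (z a).val} = #{a : Fin n | a.val < m} := fun z => by
      simp only [card_filter, ← sum_add_distrib]
      refine sum_congr rfl fun a _ => ?_
      split_ifs <;> omega
    have e3 : #{a | a.val < m ∧ r ≤ (y a).val} + #{a | a.val < m ∧ (y a).val < x} ≤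
        #{a | a.val < k ∧ r ≤ (y a).val ∧ (y a).val < x} + #{a : Fin n | a.val < m} := by
      simp only [card_filter, ← sum_add_distrib]
      refine sum_le_sum fun a _ => ?_
      have := hm a
      split_ifs <;> omega
    have e4 : #{a | a.val < k ∧ r ≤ (u a).val ∧ (v a).val < x} =
        #{a | a.val < m ∧ r ≤ (u a).val} := by
      congr 1
      ext a
      have := hm a
      simp
      omega
    have := e2 u
    have := e2 y
    omega
  · intro r x
    obtain ⟨m₀, hm₀⟩ := exists_threshold hv.2 r
    set m := max m₀ k
    have hm : ∀ a : Fin n, m ≤ a.val ↔ k ≤ a.val ∧ r ≤ (v a).val := fun a => by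
      have := hm₀ a
      simp only [Set.mem_ofPred_eq] at this
      omega
    have h1 := huy m x
    have h2 := hyv m r
    have e0 : #{i ∈ (initialSet y k)ᶜ | r ≤ i.val ∧ i.val < x} =
        #{a | k ≤ a.val ∧ r ≤ (y a).val ∧ (y a).val < x} := by
      rw [← filter_univ_mem (initialSet y k)ᶜ, filter_filter,
        ← card_filter_comp_perm y]
      simp only [mem_compl, mem_initialSet, not_lt]
    rw [e0]
    have e2 : ∀ (z : Equiv.Perm (Fin n)) (t : ℕ), #{a | a.val < m ∧ (z a).val < t} +
        #{a | m ≤ a.val ∧ (z a).val < t} = #{i : Fin n | i.val < t} := fun z t => by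
      rw [← card_filter_comp_perm z (·.val < t)]
      simp only [card_filter, ← sum_add_distrib]
      refine sum_congr rfl fun a _ => ?_
      split_ifs <;> omega
    have e1 : #{a | m ≤ a.val ∧ (v a).val < r} = 0 := by
      rw [card_eq_zero, filter_eq_empty_iff]
      intro a _
      have := hm a
      omega
    have e3 : #{a | m ≤ a.val ∧ (y a).val < x} ≤
        #{a | k ≤ a.val ∧ r ≤ (y a).val ∧ (y a).val < x} +
          #{a | m ≤ a.val ∧ (y a).val < r} := by
      simp only [card_filter, ← sum_add_distrib]
      refine sum_le_sum fun a _ => ?_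
      have := hm a
      split_ifs <;> omega
    have e4 : #{a | k ≤ a.val ∧ r ≤ (v a).val ∧ (u a).val < x} =
        #{a | m ≤ a.val ∧ (u a).val < x} := by
      congr 1
      ext a
      have := hm a
      simp
      omega
    have := e2 u x
    have := e2 y x
    have := e2 v r
    have := e2 y r
    omega

/-! ### The positroid by interval conditions -/

/-- The position function of the shifted order: `i ↦ i` for `i ≥ r` and `i ↦ i + n` otherwise. -/
def shiftedPos {n : ℕ} (r i : Fin n) : ℕ := if r ≤ i then i.val else i.val + n

theorem shiftedPos_injective {n : ℕ} (r : Fin n) : Function.Injective (shiftedPos r) := by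
  intro i j h
  unfold shiftedPos at h
  apply Fin.ext
  split_ifs at h <;> omega

theorem shiftedLT_eq {n : ℕ} (r : Fin n) :
    ShiftedLT r = fun i j => shiftedPos r i < shiftedPos r j := by
  funext i j
  apply propext
  simp only [ShiftedLT, shiftedPos, Fin.le_def, Fin.lt_def]
  split_ifs <;> omega

instance {n : ℕ} (r i j : Fin n) : Decidable (ShiftedLT r i j) :=
  inferInstanceAs (Decidable (_ ∨ _ ∨ _))

namespace DecoratedPerm

variable {n : ℕ} (w : DecoratedPerm n)

theorem card_image_antiExceedances :
    #(w.antiExceedances.image w.perm.symm) = #w.antiExceedances :=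
  card_image_of_injective _ w.perm.symm.injective

theorem isGrassmannian_upper : IsGrassmannian #w.antiExceedances w.upper := by
  have := isGrassmannian_grassmannianPerm (w.antiExceedances.image w.perm.symm)
  rwa [card_image_antiExceedances] at this

theorem lower_mem_antiExceedances (a : Fin n) :
    w.lower a ∈ w.antiExceedances ↔ a.val < #w.antiExceedances := by
  have h := initialSet_grassmannianPerm (w.antiExceedances.image w.perm.symm)
  rw [card_image_antiExceedances] at h
  rw [← mem_initialSet w.upper, upper, h, ← upper]
  simp [lower, Equiv.symm_apply_eq]

theorem inv_lower (a : Fin n) : w.perm⁻¹ (w.lower a) = w.upper a := by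
  simp [lower]

theorem lower_le_upper {a : Fin n} (ha : a.val < #w.antiExceedances) :
    w.lower a ≤ w.upper a := by
  have h := (w.lower_mem_antiExceedances a).2 ha
  simp only [antiExceedances, antiExceedanceSet, mem_filter, mem_univ, true_and, inv_lower] at h
  rcases h with h | ⟨h, -⟩
  · exact h.le
  · rw [← inv_lower, Equiv.Perm.inv_eq_iff_eq.2 h.symm]

theorem upper_le_lower {a : Fin n} (ha : #w.antiExceedances ≤ a.val) :
    w.upper a ≤ w.lower a := by
  have h := mt (w.lower_mem_antiExceedances a).1 (not_lt.2 ha)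
  simp only [antiExceedances, antiExceedanceSet, mem_filter, mem_univ, true_and, inv_lower] at h
  exact not_lt.1 fun h' => h (Or.inl h')

/-- The clockwise fixed points are the common values of `u` and `v` in the first `k` places. -/
theorem lower_mem_necklace (r a : Fin n) :
    w.lower a ∈ w.necklace r ↔ ShiftedLT r (w.lower a) (w.upper a) ∨
      (a.val < #w.antiExceedances ∧ w.lower a = w.upper a) := by
  have h := w.lower_mem_antiExceedances a
  simp only [antiExceedances, antiExceedanceSet, mem_filter, mem_univ, true_and, inv_lower] at h
  simp only [necklace, antiExceedanceSet, mem_filter, mem_univ, true_and, inv_lower]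
  refine or_congr_right ⟨fun hc => ?_, fun hc => ?_⟩
  · refine ⟨h.1 (Or.inr hc), ?_⟩
    rw [← inv_lower, Equiv.Perm.inv_eq_iff_eq.2 hc.1.symm]
  · rcases h.2 hc.1 with h' | h'
    · exact absurd hc.2 h'.ne
    · exact h'

theorem card_filter_necklace (r : Fin n) (p : Fin n → Prop) [DecidablePred p] :
    #{i ∈ w.necklace r | p i} = #{a | (ShiftedLT r (w.lower a) (w.upper a) ∨
      (a.val < #w.antiExceedances ∧ w.lower a = w.upper a)) ∧ p (w.lower a)} := by
  rw [← filter_univ_mem (w.necklace r), filter_filter, ← card_filter_comp_perm w.lower]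
  simp only [lower_mem_necklace]

/-- On an interval `[r, x)` that does not wrap around, the necklace set `I_r` misses the values
`u a` with `a ≥ k` and `[v a, u a]` inside the interval. -/
theorem card_necklace_interval (r : Fin n) (x : ℕ) :
    #{i ∈ w.necklace r | r.val ≤ i.val ∧ i.val < x} +
      #{a | #w.antiExceedances ≤ a.val ∧ r.val ≤ (w.upper a).val ∧ (w.lower a).val < x} =
    #{i : Fin n | r.val ≤ i.val ∧ i.val < x} := by
  rw [card_filter_necklace, ← card_filter_comp_perm w.lower fun i => r.val ≤ i.val ∧ i.val < x]
  simp only [card_filter, ← sum_add_distrib]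
  refine sum_congr rfl fun a _ => ?_
  have h1 := w.lower_le_upper (a := a)
  have h2 := w.upper_le_lower (a := a)
  simp only [ShiftedLT, Fin.le_def, Fin.lt_def, Fin.ext_iff] at *
  split_ifs <;> omega

/-- On a cyclic interval `[r, n) ∪ [0, s)`, the necklace set `I_r` has as many elements as there
are places `a < k` with `[u a, v a]` not inside the complement `[s, r)`. The values `u a`, `a ≥ k`,
that it contains are compensated by the intervals `[u a, v a]`, `a < k`, across `r`, since `u` and
`v` take equally many values below `r`. -/
theorem card_necklace_cyclic (r : Fin n) (s : ℕ) (hs : s ≤ r.val) :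
    #{i ∈ w.necklace r | r.val ≤ i.val ∨ i.val < s} +
      #{a | a.val < #w.antiExceedances ∧ s ≤ (w.lower a).val ∧ (w.upper a).val < r.val} =
    #{a : Fin n | a.val < #w.antiExceedances} := by
  have h0 : #{a | (w.lower a).val < r.val} = #{a | (w.upper a).val < r.val} :=
    (card_filter_comp_perm w.lower (·.val < r.val)).trans
      (card_filter_comp_perm w.upper (·.val < r.val)).symm
  rw [card_filter_necklace]
  -- after adding the equal counts `h0` the identity holds place by place
  refine Nat.add_right_cancel (m := #{a | (w.lower a).val < r.val}) ?_
  conv_rhs => rw [h0]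
  simp only [card_filter, ← sum_add_distrib]
  refine sum_congr rfl fun a _ => ?_
  have h1 := w.lower_le_upper (a := a)
  have h2 := w.upper_le_lower (a := a)
  simp only [ShiftedLT, Fin.le_def, Fin.lt_def, Fin.ext_iff] at *
  split_ifs <;> omega

theorem card_filter_val_lt_card : #{a : Fin n | a.val < #w.antiExceedances} =
    #w.antiExceedances := by
  rw [Fin.card_filter_val_lt, min_eq_right]
  simpa using w.antiExceedances.card_le_univ

theorem card_necklace (r : Fin n) : #(w.necklace r) = #w.antiExceedances := by
  have h := w.card_necklace_cyclic r r.val le_rfl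
  rw [card_filter_val_lt_card, filter_true_of_mem (fun i _ => le_or_gt _ _)] at h
  have : #{a | a.val < #w.antiExceedances ∧ r.val ≤ (w.lower a).val ∧
      (w.upper a).val < r.val} = 0 := by
    rw [card_eq_zero, filter_eq_empty_iff]
    rintro a - ⟨h1, h2, h3⟩
    have := w.lower_le_upper h1
    rw [Fin.le_def] at this
    omega
  omega

theorem galeLE_necklace_iff (r : Fin n) (I : Finset (Fin n)) (hI : #I = #w.antiExceedances) :
    GaleLE (ShiftedLT r) (w.necklace r) I ↔
      (∀ x : ℕ, #{i ∈ I | r.val ≤ i.val ∧ i.val < x} ≤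
        #{i ∈ w.necklace r | r.val ≤ i.val ∧ i.val < x}) ∧
      ∀ s ≤ r.val, #{i ∈ I | r.val ≤ i.val ∨ i.val < s} ≤
        #{i ∈ w.necklace r | r.val ≤ i.val ∨ i.val < s} := by
  rw [shiftedLT_eq, galeLE_iff_card _ (shiftedPos_injective r), card_necklace, hI]
  simp only [true_and]
  have e1 : ∀ x ≤ n, ∀ i : Fin n, shiftedPos r i < x ↔ r.val ≤ i.val ∧ i.val < x :=
    fun x hx i => by
      simp only [shiftedPos, Fin.le_def]
      split_ifs <;> omega
  have e2 : ∀ s ≤ r.val, ∀ i : Fin n, shiftedPos r i < n + s ↔ r.val ≤ i.val ∨ i.val < s :=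
    fun s hs i => by
      simp only [shiftedPos, Fin.le_def]
      split_ifs <;> omega
  constructor
  · refine fun h => ⟨fun x => ?_, fun s hs => ?_⟩
    · have := h (min x n)
      simp only [e1 _ (min_le_right x n)] at this
      simpa using this
    · simpa only [e2 s hs] using h (n + s)
  · rintro ⟨h1, h2⟩ x
    rcases le_total x n with hx | hx
    · simpa only [e1 x hx] using h1 x
    rcases le_total x (n + r.val) with hx' | hx'
    · obtain ⟨s, rfl⟩ := Nat.exists_eq_add_of_le hx
      have hs : s ≤ r.val := by omega
      simpa only [e2 s hs] using h2 s hs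
    · -- every element lies before position `n + r`
      have e3 : ∀ i : Fin n, shiftedPos r i < x := fun i => by
        simp only [shiftedPos, Fin.le_def]
        split_ifs <;> omega
      simp [e3, card_necklace, hI]

theorem mem_positroid_iff (I : Finset (Fin n)) :
    I ∈ w.positroid ↔ #I = #w.antiExceedances ∧
      IntervalConditions #w.antiExceedances w.lower w.upper I := by
  refine and_congr_right fun hI => ?_
  have hcyc : ∀ (r s : ℕ), s ≤ r →
      #{i ∈ I | r ≤ i.val ∨ i.val < s} + #{i ∈ I | s ≤ i.val ∧ i.val < r} = #I := by
    intro r s hs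
    rw [← card_union_of_disjoint]
    · congr 1
      ext i
      simp only [mem_union, mem_filter]
      have : (r ≤ i.val ∨ i.val < s) ∨ (s ≤ i.val ∧ i.val < r) := by omega
      tauto
    · rw [disjoint_left]
      intro i h1 h2
      simp only [mem_filter] at h1 h2
      omega
  constructor
  · intro h
    have h' := fun r => (w.galeLE_necklace_iff r I hI).1 (h r)
    have hB : ∀ r x : ℕ, #{a | #w.antiExceedances ≤ a.val ∧ r ≤ (w.upper a).val ∧
        (w.lower a).val < x} ≤ #{i ∈ Iᶜ | r ≤ i.val ∧ i.val < x} := by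
      intro r x
      rcases lt_or_ge r n with hr | hr
      · have h1 := (h' ⟨r, hr⟩).1 x
        have h2 := w.card_necklace_interval ⟨r, hr⟩ x
        have h3 := card_filter_add_card_filter_compl I fun i => r ≤ i.val ∧ i.val < x
        simp only at h1 h2
        omega
      · rw [card_eq_zero.2]
        · exact Nat.zero_le _
        · rw [filter_eq_empty_iff]
          intro a _
          omega
    refine ⟨fun s r => ?_, hB⟩
    rcases le_or_gt s r with hs | hs
    · rcases lt_or_ge r n with hr | hr
      · have h1 := (h' ⟨r, hr⟩).2 s hs
        have h2 := w.card_necklace_cyclic ⟨r, hr⟩ s hs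
        have h3 := hcyc r s hs
        rw [card_filter_val_lt_card] at h2
        simp only at h1 h2
        omega
      · -- intervals `[s, n)` are handled by the second condition on `[0, s)`
        have h1 := hB 0 s
        have h2 := card_filter_add_card_filter_compl I fun i => i.val < s
        rw [← card_filter_comp_perm w.lower fun i => i.val < s] at h2
        have h3 := hcyc r s hs
        have e : #{a | (w.lower a).val < s} + #{a | a.val < #w.antiExceedances ∧
            s ≤ (w.lower a).val ∧ (w.upper a).val < r} =
            #{a | #w.antiExceedances ≤ a.val ∧ (w.lower a).val < s} +
            #{a : Fin n | a.val < #w.antiExceedances} := by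
          simp only [card_filter, ← sum_add_distrib]
          refine sum_congr rfl fun a _ => ?_
          split_ifs <;> omega
        have e' : #{i ∈ I | r ≤ i.val ∨ i.val < s} = #{i ∈ I | i.val < s} := by
          congr 1
          ext i
          simp only [mem_filter]
          have : ¬ r ≤ i.val := by omega
          tauto
        rw [card_filter_val_lt_card] at e
        simp only [Nat.zero_le, true_and] at h1
        omega
    · rw [card_eq_zero.2]
      · exact Nat.zero_le _
      · rw [filter_eq_empty_iff]
        rintro a - ⟨h1, h2, h3⟩
        have := w.lower_le_upper h1
        rw [Fin.le_def] at this
        omega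
  · rintro ⟨hA, hB⟩ r
    refine (w.galeLE_necklace_iff r I hI).2 ⟨fun x => ?_, fun s hs => ?_⟩
    · have h1 := hB r x
      have h2 := w.card_necklace_interval r x
      have h3 := card_filter_add_card_filter_compl I fun i => r.val ≤ i.val ∧ i.val < x
      omega
    · have h1 := hA s r
      have h2 := w.card_necklace_cyclic r s hs
      have h3 := hcyc r s hs
      rw [card_filter_val_lt_card] at h2
      omega

end DecoratedPerm

end

theorem mainTheorem2 (n k : ℕ) (w : DecoratedPerm n)
    (hw : w ∈ DecoratedPerm.withAntiExceedances n k) :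
    w.positroid = {I | ∃ y ∈ w.grassmannInterval, I = initialSet y k} := by
  obtain rfl : w.antiExceedances.card = k := hw
  ext I
  rw [w.mem_positroid_iff]
  constructor
  · rintro ⟨-, h⟩
    exact h.exists_perm (fun _ => w.lower_le_upper) (fun _ => w.upper_le_lower)
  · rintro ⟨y, hy, rfl⟩
    exact ⟨(card_initialSet y _).trans w.card_filter_val_lt_card,
      intervalConditions_of_mem_bruhatInterval w.isGrassmannian_upper hy⟩
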